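/- For integers $r,s\ge 3$ and $\ell\ge 1$, let $D_{r,s,\ell}$ be the dumbbell graph, obtained from two vertex-disjoint cycles $C_r$ and $C_s$ by choosing one vertex on each and joining the two chosen vertices by a path of length $\ell$; it has $r+s+\ell-1$ vertices. A complex unit gain graph $\Phi=(D_{r,s,\ell},\varphi)$ assigns to every oriented edge $(u,v)$ a complex number $\varphi(u,v)$ of modulus $1$ with $\varphi(v,u)=\varphi(u,v)^{-1}$. Its Hermitian adjacency matrix $A(\Phi)$ has $(u,v)$ entry $\varphi(u,v)$ if $u,v$ are adjacent and $0$ otherwise, and its energy is $E(\Phi)=\sum_j|\lambda_j|$, where the $\lambda_j$ are the eigenvalues of $A(\Phi)$ counted with multiplicity. Let $\gamma_r=\varphi(C_r)$ and $\gamma_s=\varphi(C_s)$ be the products of the gains of the edges along the two cycles, each traversed once (the real parts do not depend on the direction or the starting vertex). **Theorem.** Let $r,s\ge 3$ be odd, let $\ell\ge 1$, and for a complex unit gain graph $\Phi$ on $D_{r,s,\ell}$ put $$\alpha=(-1)^{(r+1)/2}\operatorname{Re}\gamma_r,\qquad \beta=(-1)^{(s+1)/2}\operatorname{Re}\gamma_s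 .$$ (a) If $\ell$ is even, then $\Phi$ attains the maximum of $E$ over all complex unit gain graphs on $D_{r,s,\ell}$ if and only if $(\alpha,\beta)=(1,1)$ or $(\alpha,\beta)=(-1,-1)$. (b) If $\ell$ is odd, then $\Phi$ attains the maximum of $E$ over all complex unit gain graphs on $D_{r,s,\ell}$ if and only if $(\alpha,\beta)=(1,-1)$ or $(\alpha,\beta)=(-1,1)$. In each case, both of the pairs listed occur for some $\Phi$, so the maximum is attained, and it is attained at both pairs. -/

import Mathlib

/-- A complex unit gain on a simple graph `G`: every oriented edge (dart) receives a complex number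
of modulus one, and reversing the orientation inverts the gain. -/
structure UnitGain {V : Type*} (G : SimpleGraph V) where
  gain : G.Dart → Circle
  gain_symm : ∀ d : G.Dart, gain d.symm = (gain d)⁻¹

namespace UnitGain

variable {V : Type*} {G : SimpleGraph V}

open Classical in
/-- The Hermitian adjacency matrix: the `(u, v)` entry is the gain of the oriented edge `(u, v)` if
`u` and `v` are adjacent, and `0` otherwise. -/
noncomputable def adjMatrix (Φ : UnitGain G) : Matrix V V ℂ :=
  Matrix.of fun u v => if h : G.Adj u v then (Φ.gain ⟨(u, v), h⟩ : ℂ) else 0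

theorem adjMatrix_isHermitian (Φ : UnitGain G) : Φ.adjMatrix.IsHermitian := by
  ext u v
  simp only [adjMatrix, Matrix.conjTranspose_apply, Matrix.of_apply]
  by_cases h : G.Adj u v
  · rw [dif_pos h, dif_pos h.symm]
    have := Φ.gain_symm ⟨(u, v), h⟩
    have h2 : (⟨(u, v), h⟩ : G.Dart).symm = ⟨(v, u), h.symm⟩ := rfl
    rw [h2] at this
    rw [this, Circle.coe_inv_eq_conj]
    simp
  · rw [dif_neg h, dif_neg (fun h' => h h'.symm)]
    simp

/-- The energy: the sum of the absolute values of the eigenvalues (with multiplicity) of the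
Hermitian adjacency matrix. -/
noncomputable def energy [Fintype V] [DecidableEq V] (Φ : UnitGain G) : ℝ :=
  ∑ j, |Φ.adjMatrix_isHermitian.eigenvalues j|

end UnitGain

/-- The oriented edge `(i, i + 1)` (indices modulo `n`) of the cycle `C_n`. -/
def cycleDart (n : ℕ) (hn : 3 ≤ n) (i : Fin n) : (SimpleGraph.cycleGraph n).Dart :=
  ⟨(i, finRotate n i), by
    obtain ⟨m, rfl⟩ : ∃ m, n = m + 2 := ⟨n - 2, by omega⟩
    simp [SimpleGraph.cycleGraph_adj]⟩

/-- The gain of a cycle `c` of length `n` in `G`: the product of the gains of its consecutive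
oriented edges `(c 0, c 1), …, (c (n - 2), c (n - 1)), (c (n - 1), c 0)`. -/
noncomputable def UnitGain.cycleGain {V : Type*} {G : SimpleGraph V} (Φ : UnitGain G)
    {n : ℕ} (hn : 3 ≤ n) (c : SimpleGraph.cycleGraph n ↪g G) : Circle :=
  ∏ i : Fin n, Φ.gain (c.toHom.mapDart (cycleDart n hn i))

/-- The dumbbell graph `D_{r,s,ℓ}` on the vertices `0, 1, …, r + s + ℓ - 2`. Consecutive vertices
are adjacent, and there are two more edges, `{0, r - 1}` and `{r + ℓ - 1, r + s + ℓ - 2}`.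
Thus `0, …, r - 1` form the cycle `C_r`, the vertices `r + ℓ - 1, …, r + s + ℓ - 2` form the cycle
`C_s`, and `r - 1, r, …, r + ℓ - 1` is the path of length `ℓ` that joins them. -/
def dumbbell (r s ℓ : ℕ) : SimpleGraph (Fin (r + s + ℓ - 1)) :=
  SimpleGraph.fromRel fun i j =>
    (i : ℕ) + 1 = j ∨
    ((i : ℕ) = 0 ∧ (j : ℕ) + 1 = r) ∨
    ((i : ℕ) + 1 = r + ℓ ∧ (j : ℕ) + 2 = r + s + ℓ)

theorem cycleGraph_adj_val {n : ℕ} (hn : 3 ≤ n) (i j : Fin n) :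
    (SimpleGraph.cycleGraph n).Adj i j ↔
      (i : ℕ) + 1 = j ∨ (j : ℕ) + 1 = i ∨
        ((i : ℕ) = 0 ∧ (j : ℕ) + 1 = n) ∨ ((j : ℕ) = 0 ∧ (i : ℕ) + 1 = n) := by
  rw [SimpleGraph.cycleGraph_adj']
  have hi := i.isLt
  have hj := j.isLt
  rcases lt_trichotomy (i : ℕ) j with h | h | h
  · rw [Fin.coe_sub_iff_lt.2 h, Fin.coe_sub_iff_le.2 h.le]
    omega
  · have : i = j := Fin.ext h
    subst this
    rw [Fin.coe_sub_iff_le.2 le_rfl]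
    omega
  · rw [Fin.coe_sub_iff_lt.2 h, Fin.coe_sub_iff_le.2 h.le]
    omega

/-- The cycle `C_r` of the dumbbell graph. -/
def dumbbellLeft (r s ℓ : ℕ) (hr : 3 ≤ r) (hs : 3 ≤ s) :
    SimpleGraph.cycleGraph r ↪g dumbbell r s ℓ where
  toFun i := ⟨i, by omega⟩
  inj' i j h := by simpa [Fin.ext_iff] using h
  map_rel_iff' {i j} := by
    rw [cycleGraph_adj_val hr]
    simp only [dumbbell, SimpleGraph.fromRel_adj, ne_eq, Fin.ext_iff]
    dsimp only [DFunLike.coe]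
    omega

/-- The cycle `C_s` of the dumbbell graph. -/
def dumbbellRight (r s ℓ : ℕ) (hr : 3 ≤ r) (hs : 3 ≤ s) :
    SimpleGraph.cycleGraph s ↪g dumbbell r s ℓ where
  toFun i := ⟨r + ℓ - 1 + i, by omega⟩
  inj' i j h := by simpa [Fin.ext_iff] using h
  map_rel_iff' {i j} := by
    rw [cycleGraph_adj_val hs]
    simp only [dumbbell, SimpleGraph.fromRel_adj, ne_eq, Fin.ext_iff]
    dsimp only [DFunLike.coe]
    omega

/-- `α = (-1)^((r+1)/2) Re γ_r`, where `γ_r` is the gain of the cycle `C_r` (used for odd `r`). -/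
noncomputable def oddAlpha {r s ℓ : ℕ} (hr : 3 ≤ r) (hs : 3 ≤ s)
    (Φ : UnitGain (dumbbell r s ℓ)) : ℝ :=
  (-1) ^ ((r + 1) / 2) * (Φ.cycleGain hr (dumbbellLeft r s ℓ hr hs) : ℂ).re

/-- `β = (-1)^((s+1)/2) Re γ_s`, where `γ_s` is the gain of the cycle `C_s` (used for odd `s`). -/
noncomputable def oddBeta {r s ℓ : ℕ} (hr : 3 ≤ r) (hs : 3 ≤ s)
    (Φ : UnitGain (dumbbell r s ℓ)) : ℝ :=
  (-1) ^ ((s + 1) / 2) * (Φ.cycleGain hs (dumbbellRight r s ℓ hr hs) : ℂ).re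

/-! By Coulson's formula, the energy times a positive constant is the integral over t > 0 of log
|det(it - A)|², up to a summand depending only on t and the number of vertices. Hence an inequality
between these squared moduli at every t passes to the energies, and a strict one at every t stays
strict (`sum_abs_eigenvalues_le`, `sum_abs_eigenvalues_lt`).

Cutting at the bridge writes the determinant in terms of path polynomials and the polynomials of the
two cycles; the latter see the gains only through -2 Re γ (`det_block_dumbbell`, `det_block_cycle`).
At z = it a path polynomial is a power of i times a nonnegative real, and an odd cycle gives a
unimodular factor times a - 2iα with a > 0. So |det(it - A)|² is an explicit polynomial in α and β
(`normSq_det_dumbbell`).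

In that polynomial the cross terms collapse, by the Cassini-type identity `lucasSeq_sq`, to a
positive multiple of (-1)^ℓ αβ. Therefore some B independent of the gains exceeds |det(it - A)|² by
a combination, with positive coefficients, of 1 - α²β², 1 - α², 1 - β² and 1 - (-1)^ℓ αβ
(`exists_form_sub_normSq_det_dumbbell`). All four are nonnegative, and they vanish together exactly
when α² = β² = 1 and (-1)^ℓ αβ = 1, a condition free of t. Gains ±1 on the closing edges of the
cycles realize every sign pattern. -/

/-! ### The integral behind Coulson's formula. -/

open MeasureTheory in
theorem integrableOn_log_one_add_inv_sq :
    IntegrableOn (fun t : ℝ => Real.log (1 + (1 / t) ^ 2)) (Set.Ioi 0) := by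
  rw [← Set.Ioc_union_Ioi_eq_Ioi (zero_le_one' ℝ)]
  refine IntegrableOn.union ?_ ?_
  · have h1 : IntervalIntegrable (fun t : ℝ => Real.log (1 + t ^ 2) - 2 * Real.log t)
        volume 0 1 := by
      refine IntervalIntegrable.sub ?_ (intervalIntegral.intervalIntegrable_log'.const_mul 2)
      refine Continuous.intervalIntegrable ?_ _ _
      exact Continuous.log (by fun_prop) (fun x => by positivity)
    rw [intervalIntegrable_iff_integrableOn_Ioc_of_le zero_le_one] at h1
    refine h1.congr_fun ?_ measurableSet_Ioc
    intro t ht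
    have h0 : t ≠ 0 := ht.1.ne'
    have h2 : 1 + (1 / t) ^ 2 = (1 + t ^ 2) / t ^ 2 := by field_simp; ring
    simp only [h2]
    rw [Real.log_div (by positivity) (by positivity), Real.log_pow]
    simp
  · have h1 : IntegrableOn (fun t : ℝ => t ^ (-2 : ℝ)) (Set.Ioi 1) :=
      integrableOn_Ioi_rpow_of_lt (by norm_num) one_pos
    refine h1.mono' ?_ ?_
    · exact (Measurable.log (by fun_prop)).aestronglyMeasurable
    · refine (ae_restrict_iff' measurableSet_Ioi).2 (ae_of_all _ fun t ht => ?_)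
      have h0 : (0 : ℝ) < t := zero_lt_one.trans ht
      have h2 : 0 ≤ Real.log (1 + (1 / t) ^ 2) :=
        Real.log_nonneg (by have := sq_nonneg (1 / t); linarith)
      rw [Real.norm_of_nonneg h2, Real.rpow_neg h0.le]
      have := Real.log_le_sub_one_of_pos (show 0 < 1 + (1 / t) ^ 2 by positivity)
      have h3 : t ^ (2 : ℝ) = t ^ 2 := by norm_cast
      rw [h3]
      simpa using this

open MeasureTheory in
theorem integrableOn_log_one_add_div_sq (c : ℝ) :
    IntegrableOn (fun t : ℝ => Real.log (1 + (c / t) ^ 2)) (Set.Ioi 0) := by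
  rcases eq_or_ne c 0 with rfl | hc
  · simp
  · have hc' : 0 < |c|⁻¹ := by positivity
    have := (integrableOn_Ioi_comp_mul_left_iff
      (fun t : ℝ => Real.log (1 + (1 / t) ^ 2)) 0 hc').2
      (by simpa using integrableOn_log_one_add_inv_sq)
    refine this.congr_fun ?_ measurableSet_Ioi
    intro t _
    have : (1 / (|c|⁻¹ * t)) ^ 2 = (c / t) ^ 2 := by
      rw [one_div, mul_inv, inv_inv, mul_pow, sq_abs, div_eq_mul_inv, mul_pow]
    simp only [this]

-- Substituting t ↦ t/|c| pulls out the factor |c|; this is where absolute values of eigenvalues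
-- come from.
open MeasureTheory in
theorem integral_log_one_add_div_sq (c : ℝ) :
    ∫ t in Set.Ioi (0 : ℝ), Real.log (1 + (c / t) ^ 2) =
      |c| * ∫ t in Set.Ioi (0 : ℝ), Real.log (1 + (1 / t) ^ 2) := by
  rcases eq_or_ne c 0 with rfl | hc
  · simp
  · have hc' : 0 < |c|⁻¹ := by positivity
    have := integral_comp_mul_left_Ioi (fun t : ℝ => Real.log (1 + (1 / t) ^ 2)) 0 hc'
    rw [mul_zero, inv_inv, smul_eq_mul] at this
    rw [← this]
    refine setIntegral_congr_fun measurableSet_Ioi fun t _ => ?_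
    have : (1 / (|c|⁻¹ * t)) ^ 2 = (c / t) ^ 2 := by
      rw [one_div, mul_inv, inv_inv, mul_pow, sq_abs, div_eq_mul_inv, mul_pow]
    simp only [this]

open MeasureTheory in
theorem setIntegral_Ioi_pos_of_pos {f : ℝ → ℝ} (hf : IntegrableOn f (Set.Ioi 0))
    (hpos : ∀ t, 0 < t → 0 < f t) : 0 < ∫ t in Set.Ioi (0 : ℝ), f t := by
  rw [setIntegral_pos_iff_support_of_nonneg_ae
    ((ae_restrict_iff' measurableSet_Ioi).2 (ae_of_all _ fun t ht => (hpos t ht).le)) hf]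
  have : Function.support f ∩ Set.Ioi 0 = Set.Ioi 0 :=
    Set.inter_eq_right.2 fun t ht => (hpos t ht).ne'
  rw [this]
  simp

/-- Comparing energies needs only the sign of the normalizing constant, so its value is never
computed. -/
theorem integral_log_one_add_inv_sq_pos :
    0 < ∫ t in Set.Ioi (0 : ℝ), Real.log (1 + (1 / t) ^ 2) :=
  setIntegral_Ioi_pos_of_pos integrableOn_log_one_add_inv_sq fun t ht =>
    Real.log_pos (by have : 0 < (1 / t) ^ 2 := by positivity
                     linarith)

/-! ### Comparing sums of |λ| through determinants on the imaginary axis. -/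

namespace Matrix.IsHermitian

variable {V : Type*} [Fintype V] [DecidableEq V]

theorem det_scalar_sub {A : Matrix V V ℂ} (hA : A.IsHermitian) (z : ℂ) :
    (Matrix.scalar V z - A).det = ∏ j, (z - hA.eigenvalues j) := by
  rw [← Matrix.eval_charpoly, hA.charpoly_eq, Polynomial.eval_prod]
  simp

theorem normSq_det_I_mul_sub {A : Matrix V V ℂ} (hA : A.IsHermitian) (t : ℝ) :
    Complex.normSq (Matrix.scalar V (Complex.I * t) - A).det =
      ∏ j, (t ^ 2 + hA.eigenvalues j ^ 2) := by
  rw [hA.det_scalar_sub, map_prod]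
  refine Finset.prod_congr rfl fun j _ => ?_
  simp [Complex.normSq_apply]
  ring

theorem isUnit_det_I_mul_sub {A : Matrix V V ℂ} (hA : A.IsHermitian) {t : ℝ} (ht : 0 < t) :
    IsUnit (Matrix.scalar V (Complex.I * t) - A).det := by
  rw [isUnit_iff_ne_zero, ← Complex.normSq_pos, hA.normSq_det_I_mul_sub]
  exact Finset.prod_pos fun j _ => by positivity

/-- The subtracted term depends only on t and the size, so it cancels when two matrices are
compared. -/
theorem sum_log_eigenvalues {A : Matrix V V ℂ} (hA : A.IsHermitian) {t : ℝ} (ht : 0 < t) :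
    ∑ j, Real.log (1 + (hA.eigenvalues j / t) ^ 2) =
      Real.log (Complex.normSq (Matrix.scalar V (Complex.I * t) - A).det) -
        Fintype.card V * Real.log (t ^ 2) := by
  rw [hA.normSq_det_I_mul_sub, Real.log_prod (fun j _ => by positivity), Fintype.card,
    ← nsmul_eq_mul, ← Finset.sum_const, ← Finset.sum_sub_distrib]
  refine Finset.sum_congr rfl fun j _ => ?_
  rw [← Real.log_div (by positivity) (by positivity)]
  congr 1
  field_simp

open MeasureTheory in
/-- Coulson's integral formula, up to the normalizing constant. -/
theorem sum_abs_eigenvalues_mul {A : Matrix V V ℂ} (hA : A.IsHermitian) :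
    (∑ j, |hA.eigenvalues j|) * ∫ t in Set.Ioi (0 : ℝ), Real.log (1 + (1 / t) ^ 2) =
      ∫ t in Set.Ioi (0 : ℝ), ∑ j, Real.log (1 + (hA.eigenvalues j / t) ^ 2) := by
  rw [integral_finsetSum _ fun j _ => integrableOn_log_one_add_div_sq _, Finset.sum_mul]
  exact Finset.sum_congr rfl fun j _ => (integral_log_one_add_div_sq _).symm

open MeasureTheory in
theorem sum_abs_eigenvalues_le {A B : Matrix V V ℂ} (hA : A.IsHermitian) (hB : B.IsHermitian)
    (h : ∀ t : ℝ, 0 < t → Complex.normSq (Matrix.scalar V (Complex.I * t) - A).det ≤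
      Complex.normSq (Matrix.scalar V (Complex.I * t) - B).det) :
    ∑ j, |hA.eigenvalues j| ≤ ∑ j, |hB.eigenvalues j| := by
  refine le_of_mul_le_mul_right ?_ integral_log_one_add_inv_sq_pos
  rw [hA.sum_abs_eigenvalues_mul, hB.sum_abs_eigenvalues_mul]
  refine setIntegral_mono_on (integrable_finsetSum _ fun j _ => integrableOn_log_one_add_div_sq _)
    (integrable_finsetSum _ fun j _ => integrableOn_log_one_add_div_sq _) measurableSet_Ioi
    fun t ht => ?_
  rw [hA.sum_log_eigenvalues ht, hB.sum_log_eigenvalues ht]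
  exact sub_le_sub_right (Real.log_le_log
    (Complex.normSq_pos.2 (hA.isUnit_det_I_mul_sub ht).ne_zero) (h t ht)) _

open MeasureTheory in
theorem sum_abs_eigenvalues_lt {A B : Matrix V V ℂ} (hA : A.IsHermitian) (hB : B.IsHermitian)
    (h : ∀ t : ℝ, 0 < t → Complex.normSq (Matrix.scalar V (Complex.I * t) - A).det <
      Complex.normSq (Matrix.scalar V (Complex.I * t) - B).det) :
    ∑ j, |hA.eigenvalues j| < ∑ j, |hB.eigenvalues j| := by
  refine lt_of_mul_lt_mul_right ?_ integral_log_one_add_inv_sq_pos.le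
  have iA := integrable_finsetSum Finset.univ
    fun j _ => integrableOn_log_one_add_div_sq (hA.eigenvalues j)
  have iB := integrable_finsetSum Finset.univ
    fun j _ => integrableOn_log_one_add_div_sq (hB.eigenvalues j)
  rw [hA.sum_abs_eigenvalues_mul, hB.sum_abs_eigenvalues_mul, ← sub_pos, ← integral_sub iB iA]
  refine setIntegral_Ioi_pos_of_pos (iB.sub iA) fun t ht => ?_
  rw [hA.sum_log_eigenvalues ht, hB.sum_log_eigenvalues ht, sub_sub_sub_cancel_right, sub_pos]
  exact Real.log_lt_log (Complex.normSq_pos.2 (hA.isUnit_det_I_mul_sub ht).ne_zero) (h t ht)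

end Matrix.IsHermitian

/-! ### The recurrence satisfied by path polynomials. -/

/-- The solution of `u (k + 2) = z * u (k + 1) + c * u k` with `u 0 = 0`, `u 1 = 1`. -/
def lucasSeq {R : Type*} [CommRing R] (c z : R) : ℕ → R
  | 0 => 0
  | 1 => 1
  | k + 2 => z * lucasSeq c z (k + 1) + c * lucasSeq c z k

/-- One step of the recurrence multiplies this quadratic form by -c. For c = 1 it supplies the sign
(-1)^ℓ that separates even from odd ℓ. -/
theorem lucasSeq_sq {R : Type*} [CommRing R] (c z : R) (k : ℕ) :
    lucasSeq c z (k + 1) ^ 2 - z * lucasSeq c z k * lucasSeq c z (k + 1)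
      - c * lucasSeq c z k ^ 2 = (-c) ^ k := by
  induction k with
  | zero => simp [lucasSeq]
  | succ k ih =>
    rw [pow_succ (-c), ← ih, show lucasSeq c z (k + 1 + 1) =
      z * lucasSeq c z (k + 1) + c * lucasSeq c z k from rfl]
    ring

theorem lucasSeq_succ_pos {t : ℝ} (ht : 0 < t) (k : ℕ) :
    0 ≤ lucasSeq 1 t k ∧ 0 < lucasSeq 1 t (k + 1) := by
  induction k with
  | zero => simp [lucasSeq]
  | succ k ih =>
    refine ⟨ih.2.le, ?_⟩
    rw [lucasSeq]
    have := mul_pos ht ih.2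
    linarith [ih.1]

/-- The extra factor i on the left avoids the exponent k - 1 at k = 0. -/
theorem I_mul_lucasSeq (t : ℝ) (k : ℕ) :
    Complex.I * lucasSeq (-1) (Complex.I * t) k = Complex.I ^ k * (lucasSeq 1 t k : ℝ) := by
  induction k using Nat.strong_induction_on with
  | _ k ih =>
    match k with
    | 0 => simp [lucasSeq]
    | 1 => simp [lucasSeq]
    | k + 2 =>
      have h1 := ih (k + 1) (by omega)
      have h2 := ih k (by omega)
      rw [lucasSeq, lucasSeq]
      push_cast
      linear_combination Complex.I * t * h1 - h2 -
        Complex.I ^ k * (lucasSeq 1 t k : ℝ) * Complex.I_sq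

/-! ### Determinants of paths, bridges and cycles, on matrices indexed by ℕ so that subblocks need
no casts. -/

namespace NatMatrix

variable {R : Type*}

/-- The leading `n × n` block of an infinite matrix. -/
def block (M : ℕ → ℕ → R) (n : ℕ) : Matrix (Fin n) (Fin n) R :=
  Matrix.of fun i j => M i j

/-- The infinite matrix obtained by deleting the first `a` rows and columns. -/
def shift (M : ℕ → ℕ → R) (a : ℕ) : ℕ → ℕ → R := fun i j => M (a + i) (a + j)

theorem shift_shift (M : ℕ → ℕ → R) (a b : ℕ) : shift (shift M a) b = shift M (a + b) := by
  funext i j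
  simp [shift, add_assoc]

theorem det_block_add_two [CommRing R] (M : ℕ → ℕ → R) (n : ℕ)
    (h1 : ∀ j, 2 ≤ j → j < n + 2 → M 0 j = 0) (h2 : ∀ j, 2 ≤ j → j < n + 2 → M j 0 = 0) :
    (block M (n + 2)).det = M 0 0 * (block (shift M 1) (n + 1)).det -
      M 0 1 * M 1 0 * (block (shift M 2) n).det := by
  rw [Matrix.det_succ_row_zero, Fin.sum_univ_succ, Fin.sum_univ_succ, Finset.sum_eq_zero]
  · have e1 : (block M (n + 2)).submatrix Fin.succ (Fin.succAbove 0) = block (shift M 1) (n + 1) := by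
      ext i j
      simp [block, shift, add_comm]
    have e2 : ((block M (n + 2)).submatrix Fin.succ (Fin.succAbove (Fin.succ 0))).det =
        M 1 0 * (block (shift M 2) n).det := by
      rw [Matrix.det_succ_column_zero, Fin.sum_univ_succ, Finset.sum_eq_zero]
      · have e3 : ((block M (n + 2)).submatrix Fin.succ (Fin.succAbove (Fin.succ 0))).submatrix
            (Fin.succAbove 0) Fin.succ = block (shift M 2) n := by
          ext i j
          simp [block, shift, add_comm 2]
        rw [e3]
        simp [block]
      · intro i _
        have := h2 (i + 2) (by omega) (by omega)
        simp [block, this, add_assoc]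
    rw [e1, e2]
    simp [block]
    ring
  · intro i _
    have := h1 (i + 2) (by omega) (by omega)
    simp [block, this, add_assoc]

/-- The leading `n × n` block is tridiagonal with diagonal entries `z`, and the products of opposite
off-diagonal entries are `1`. -/
structure IsPath [CommRing R] (M : ℕ → ℕ → R) (z : R) (n : ℕ) : Prop where
  diag : ∀ i, i < n → M i i = z
  mul : ∀ i, i + 1 < n → M i (i + 1) * M (i + 1) i = 1
  upper : ∀ i j, i + 2 ≤ j → j < n → M i j = 0
  lower : ∀ i j, i + 2 ≤ j → j < n → M j i = 0

theorem IsPath.shift [CommRing R] {M : ℕ → ℕ → R} {z : R} {a n : ℕ} (h : IsPath M z (a + n)) :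
    IsPath (shift M a) z n where
  diag i hi := h.diag (a + i) (by omega)
  mul i hi := h.mul (a + i) (by omega)
  upper i j hij hj := h.upper (a + i) (a + j) (by omega) (by omega)
  lower i j hij hj := h.lower (a + i) (a + j) (by omega) (by omega)

theorem IsPath.mono [CommRing R] {M : ℕ → ℕ → R} {z : R} {m n : ℕ} (h : IsPath M z n)
    (hmn : m ≤ n) : IsPath M z m where
  diag i hi := h.diag i (by omega)
  mul i hi := h.mul i (by omega)
  upper i j hij hj := h.upper i j hij (by omega)
  lower i j hij hj := h.lower i j hij (by omega)

/-- Expanding at the first vertex gives the three-term recurrence. The index is one more than the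
number of vertices. -/
theorem IsPath.det_block [CommRing R] {M : ℕ → ℕ → R} {z : R} {n : ℕ} (h : IsPath M z n) :
    (block M n).det = lucasSeq (-1) z (n + 1) := by
  induction n using Nat.strong_induction_on generalizing M with
  | _ n ih =>
    match n with
    | 0 => simp [lucasSeq]
    | 1 => simp [lucasSeq, block, h.diag 0]
    | n + 2 =>
      rw [det_block_add_two M n (fun j h1 h2 => h.upper 0 j (by omega) h2)
        (fun j h1 h2 => h.lower 0 j (by omega) h2),
        ih (n + 1) (by omega) (M := NatMatrix.shift M 1)
          (IsPath.shift (h.mono (by omega))),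
        ih n (by omega) (M := NatMatrix.shift M 2) (IsPath.shift (h.mono (by omega))),
        h.diag 0 (by omega), h.mul 0 (by omega),
        show lucasSeq (-1) z (n + 2 + 1) =
          z * lucasSeq (-1) z (n + 2) + -1 * lucasSeq (-1) z (n + 1) from rfl]
      ring

theorem adjugate_block_zero_zero [CommRing R] (M : ℕ → ℕ → R) (n : ℕ) :
    (block M (n + 1)).adjugate 0 0 = (block (shift M 1) n).det := by
  rw [Matrix.adjugate_fin_succ_eq_det_submatrix]
  have : (block M (n + 1)).submatrix (Fin.succAbove 0) (Fin.succAbove 0) = block (shift M 1) n := by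
    ext i j
    simp [block, shift, add_comm]
  rw [this]
  simp

theorem adjugate_block_last_last [CommRing R] (M : ℕ → ℕ → R) (n : ℕ) :
    (block M (n + 1)).adjugate (Fin.last n) (Fin.last n) = (block M n).det := by
  rw [Matrix.adjugate_fin_succ_eq_det_submatrix]
  have : (block M (n + 1)).submatrix (Fin.last n).succAbove (Fin.last n).succAbove = block M n := by
    ext i j
    simp [block]
  rw [this]
  simp [← two_mul]

/-- Deleting the last row and first column moves the superdiagonal onto the diagonal and leaves a
lower triangular matrix. -/
theorem adjugate_block_zero_last [CommRing R] (M : ℕ → ℕ → R) (n : ℕ)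
    (h : ∀ i j, i + 2 ≤ j → j < n + 1 → M i j = 0) :
    (block M (n + 1)).adjugate 0 (Fin.last n) =
      (-1) ^ n * ∏ i ∈ Finset.range n, M i (i + 1) := by
  rw [Matrix.adjugate_fin_succ_eq_det_submatrix, Matrix.det_of_isLowerTriangular]
  · simp [block, Finset.prod_range]
  · intro i j hij
    have hij' : i < j := hij
    have : (i : ℕ) < j := hij'
    simpa [block] using h i (j + 1) (by omega) (by omega)

theorem block_transpose (M : ℕ → ℕ → R) (n : ℕ) :
    (block M n).transpose = block (fun i j => M j i) n := rfl

theorem adjugate_block_last_zero [CommRing R] (M : ℕ → ℕ → R) (n : ℕ)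
    (h : ∀ i j, i + 2 ≤ j → j < n + 1 → M j i = 0) :
    (block M (n + 1)).adjugate (Fin.last n) 0 =
      (-1) ^ n * ∏ i ∈ Finset.range n, M (i + 1) i := by
  rw [← adjugate_block_zero_last (fun i j => M j i) n h, ← block_transpose,
    ← Matrix.adjugate_transpose, Matrix.transpose_apply]

/-- This is the Schur complement of the leading block. -/
theorem det_block_add [CommRing R] (M : ℕ → ℕ → R) (m n : ℕ) (h : IsUnit (block M m).det) :
    (block M (m + n)).det = (block M m).det * (block (shift M m) n -
      (Matrix.of fun (i : Fin n) (j : Fin m) => M (m + i) j) * (block M m)⁻¹ *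
      (Matrix.of fun (i : Fin m) (j : Fin n) => M i (m + j))).det := by
  have := Matrix.invertibleOfIsUnitDet _ h
  rw [← Matrix.invOf_eq_nonsing_inv, ← Matrix.det_fromBlocks₁₁,
    ← Matrix.det_submatrix_equiv_self finSumFinEquiv]
  congr 1
  ext (i | i) (j | j) <;> simp [block, shift]

theorem _root_.Fin.sum_univ_eq_zero_add_last {A : Type*} [AddCommMonoid A] {n : ℕ}
    (f : Fin (n + 2) → A) (h : ∀ i, i ≠ 0 → i ≠ Fin.last (n + 1) → f i = 0) :
    ∑ i, f i = f 0 + f (Fin.last (n + 1)) := by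
  rw [Fin.sum_univ_succ, Fin.sum_univ_castSucc, Finset.sum_eq_zero, zero_add, Fin.succ_last]
  intro i _
  refine h _ (Fin.succ_ne_zero _) fun h' => ?_
  have := congrArg Fin.val h'
  simp at this
  omega

/-- Two consecutive blocks joined by a single edge. -/
theorem det_block_bridge [CommRing R] (M : ℕ → ℕ → R) (m n : ℕ)
    (h : IsUnit (block M (m + 1)).det)
    (h0 : ∀ i j, i < m + 1 → j < n + 1 → ¬(i = m ∧ j = 0) → M i (m + 1 + j) = 0)
    (h1 : ∀ i j, i < m + 1 → j < n + 1 → ¬(i = m ∧ j = 0) → M (m + 1 + j) i = 0)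
    (h2 : M m (m + 1) * M (m + 1) m = 1) :
    (block M (m + 1 + (n + 1))).det =
      (block M (m + 1)).det * (block (shift M (m + 1)) (n + 1)).det -
        (block M m).det * (block (shift M (m + 2)) n).det := by
  set N := block M (m + 1) with hN
  set Q := block (shift M (m + 1)) (n + 1) with hQ
  set w := N⁻¹ (Fin.last m) (Fin.last m) with hw
  have hw' : N.det * w = (block M m).det := by
    rw [hw, Matrix.inv_def, Matrix.smul_apply, smul_eq_mul, ← mul_assoc,
      Ring.mul_inverse_cancel _ h, one_mul, hN, adjugate_block_last_last]
  -- With a single joining edge, the Schur correction lives in the (0, 0) entry only and equals w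
  -- there, so it is a change of one row.
  have key : Q - (Matrix.of fun (i : Fin (n + 1)) (j : Fin (m + 1)) => M (m + 1 + i) j) * N⁻¹ *
      (Matrix.of fun (i : Fin (m + 1)) (j : Fin (n + 1)) => M i (m + 1 + j)) =
      Q.updateRow 0 (Q 0 + (-w) • Pi.single 0 1) := by
    ext i j
    have e : ((Matrix.of fun (i : Fin (n + 1)) (j : Fin (m + 1)) => M (m + 1 + i) j) * N⁻¹ *
      (Matrix.of fun (i : Fin (m + 1)) (j : Fin (n + 1)) => M i (m + 1 + j))) i j =
        M (m + 1 + i) m * w * M m (m + 1 + j) := by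
      rw [Matrix.mul_apply, Finset.sum_eq_single (Fin.last m), Matrix.mul_apply,
        Finset.sum_eq_single (Fin.last m)]
      · simp [hw]
      · intro b _ hb
        have hb' : (b : ℕ) ≠ m := fun h => hb (Fin.ext h)
        rw [Matrix.of_apply, h1 _ _ b.2 i.2 (by tauto), zero_mul]
      · simp
      · intro b _ hb
        have hb' : (b : ℕ) ≠ m := fun h => hb (Fin.ext h)
        rw [Matrix.of_apply, h0 _ _ b.2 j.2 (by tauto), mul_zero]
      · simp
    rw [Matrix.sub_apply, e]
    rcases Fin.eq_zero_or_eq_succ i with rfl | ⟨i, rfl⟩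
    · rcases Fin.eq_zero_or_eq_succ j with rfl | ⟨j, rfl⟩
      · simp
        linear_combination -w * h2
      · rw [h0 _ _ (Nat.lt_succ_self m) (Fin.succ j).2 (by simp)]
        simp
    · rw [h1 _ _ (Nat.lt_succ_self m) (Fin.succ i).2 (by simp)]
      simp
  rw [det_block_add M (m + 1) (n + 1) h, key, Matrix.det_updateRow_add, Matrix.updateRow_eq_self,
    Matrix.det_updateRow_smul, ← Matrix.adjugate_apply, hQ, adjugate_block_zero_zero, shift_shift,
    ← hw']
  ring

/-- The leading `n × n` block is tridiagonal up to two corners, with diagonal entries `z`, and the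
products of opposite off-diagonal entries are `1`. -/
structure IsCycle [CommRing R] (M : ℕ → ℕ → R) (z : R) (n : ℕ) : Prop where
  diag : ∀ i, i < n + 1 → M i i = z
  mul : ∀ i, i < n → M i (i + 1) * M (i + 1) i = 1
  upper : ∀ i j, i + 2 ≤ j → j < n + 1 → ¬(i = 0 ∧ j = n) → M i j = 0
  lower : ∀ i j, i + 2 ≤ j → j < n + 1 → ¬(i = 0 ∧ j = n) → M j i = 0
  corner : M 0 n * M n 0 = 1

theorem IsCycle.isPath [CommRing R] {M : ℕ → ℕ → R} {z : R} {n : ℕ} (h : IsCycle M z n) :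
    IsPath M z n where
  diag i hi := h.diag i (by omega)
  mul i hi := h.mul i (by omega)
  upper i j hij hj := h.upper i j hij (by omega) (by omega)
  lower i j hij hj := h.lower i j hij (by omega) (by omega)

theorem IsCycle.isPath_shift [CommRing R] {M : ℕ → ℕ → R} {z : R} {n : ℕ} (h : IsCycle M z n) :
    IsPath (NatMatrix.shift M 1) z n where
  diag i hi := h.diag (1 + i) (by omega)
  mul i hi := h.mul (1 + i) (by omega)
  upper i j hij hj := h.upper (1 + i) (1 + j) (by omega) (by omega) (by omega)
  lower i j hij hj := h.lower (1 + i) (1 + j) (by omega) (by omega) (by omega)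

/-- Removing the last of the n + 3 vertices leaves a path, and the Schur complement is 1 × 1. The
diagonal corners of the path's adjugate give the two path terms; the off-diagonal corners give the
products around the cycle in its two directions. -/
theorem IsCycle.det_block [CommRing R] {M : ℕ → ℕ → R} {z : R} {n : ℕ} (h : IsCycle M z (n + 2))
    (hu : IsUnit (lucasSeq (-1) z (n + 3))) :
    (block M (n + 3)).det = z * lucasSeq (-1) z (n + 3) - 2 * lucasSeq (-1) z (n + 2) +
      (-1) ^ n * (M (n + 2) 0 * ∏ i ∈ Finset.range (n + 2), M i (i + 1) +
        M 0 (n + 2) * ∏ i ∈ Finset.range (n + 2), M (i + 1) i) := by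
  have hp := h.isPath
  set N := block M (n + 2) with hN
  have hd : N.det = lucasSeq (-1) z (n + 3) := hp.det_block
  have hu' : IsUnit N.det := by rwa [hd]
  have hinv : ∀ i j, N.det * N⁻¹ i j = N.adjugate i j := fun i j => by
    rw [Matrix.inv_def, Matrix.smul_apply, smul_eq_mul, ← mul_assoc,
      Ring.mul_inverse_cancel _ hu', one_mul]
  have e : ((Matrix.of fun (i : Fin 1) (j : Fin (n + 2)) => M (n + 2 + i) j) * N⁻¹ *
      (Matrix.of fun (i : Fin (n + 2)) (j : Fin 1) => M i (n + 2 + j))) 0 0 =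
      (M (n + 2) 0 * N⁻¹ 0 0 + M (n + 2) (n + 1) * N⁻¹ (Fin.last _) 0) * M 0 (n + 2) +
      (M (n + 2) 0 * N⁻¹ 0 (Fin.last _) + M (n + 2) (n + 1) * N⁻¹ (Fin.last _) (Fin.last _)) *
        M (n + 1) (n + 2) := by
    have hne : ∀ i : Fin (n + 2), i ≠ 0 → i ≠ Fin.last (n + 1) →
        (i : ℕ) + 2 ≤ n + 2 ∧ (i : ℕ) ≠ 0 := fun i h0 h1 => by
      have h0' : (i : ℕ) ≠ 0 := fun h => h0 (Fin.ext h)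
      have h1' : (i : ℕ) ≠ n + 1 := fun h => h1 (Fin.ext h)
      omega
    rw [Matrix.mul_apply, Fin.sum_univ_eq_zero_add_last]
    · rw [Matrix.mul_apply, Matrix.mul_apply, Fin.sum_univ_eq_zero_add_last,
        Fin.sum_univ_eq_zero_add_last]
      · simp
      all_goals
        intro i h0 h1
        have := hne i h0 h1
        have := h.lower i (n + 2) this.1 (by omega) (by omega)
        simp [this]
    · intro i h0 h1
      have := hne i h0 h1
      have := h.upper i (n + 2) this.1 (by omega) (by omega)
      simp [this]
  have a00 : N.adjugate 0 0 = lucasSeq (-1) z (n + 2) := by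
    rw [hN, adjugate_block_zero_zero]
    exact (IsPath.shift (a := 1) (n := n + 1) (hp.mono (by omega))).det_block
  have a11 : N.adjugate (Fin.last _) (Fin.last _) = lucasSeq (-1) z (n + 2) := by
    rw [hN, adjugate_block_last_last]
    exact (hp.mono (by omega)).det_block
  have a01 := adjugate_block_zero_last M (n + 1) hp.upper
  have a10 := adjugate_block_last_zero M (n + 1) hp.lower
  rw [← hN, ← hinv] at a01 a10
  rw [← hinv] at a00 a11
  rw [show n + 3 = n + 2 + 1 from rfl, det_block_add M (n + 2) 1 hu', Matrix.det_fin_one,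
    Matrix.sub_apply, e, ← hN, Finset.prod_range_succ _ (n + 1),
    Finset.prod_range_succ _ (n + 1), ← hd]
  have hz : block (shift M (n + 2)) 1 0 0 = z := h.diag (n + 2) (by omega)
  rw [hz]
  have hc := h.corner
  have hm := h.mul (n + 1) (by omega)
  rw [pow_succ] at a01 a10
  linear_combination (-M (n + 2) 0 * M 0 (n + 2)) * a00
    - M (n + 1) (n + 2) * M (n + 2) (n + 1) * a11
    - M (n + 2) 0 * M (n + 1) (n + 2) * a01 - M (n + 2) (n + 1) * M 0 (n + 2) * a10
    - lucasSeq (-1) z (n + 2) * hc - lucasSeq (-1) z (n + 2) * hm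

end NatMatrix

/-! ### Assembling the dumbbell determinant. -/

namespace NatMatrix

/-- A path of length `l` attached to the first vertex of a block of size `p + 1`. -/
theorem det_block_tail {R : Type*} [CommRing R] (T : ℕ → ℕ → R) (z : R) (l p : ℕ)
    (hd : ∀ i, i < l → T i i = z) (hm : ∀ i, i < l → T i (i + 1) * T (i + 1) i = 1)
    (hu : ∀ i j, i < l → i + 2 ≤ j → j < l + p + 1 → T i j = 0)
    (hl : ∀ i j, i < l → i + 2 ≤ j → j < l + p + 1 → T j i = 0) :
    (block T (l + p + 1)).det =
        (block (shift T l) (p + 1)).det * lucasSeq (-1) z (l + 1) -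
          (block (shift T (l + 1)) p).det * lucasSeq (-1) z l ∧
      (block (shift T 1) (l + p)).det =
        (block (shift T l) (p + 1)).det * lucasSeq (-1) z l -
          (block (shift T (l + 1)) p).det *
            (z * lucasSeq (-1) z l - lucasSeq (-1) z (l + 1)) := by
  -- The two identities need each other, since the recurrence uses two consecutive determinants. The
  -- combination z * L l - L (l + 1), for L the path sequence, plays the role of L (l - 1) and
  -- remains right at l = 0.
  induction l generalizing T with
  | zero =>
    have h0 : shift T 0 = T := by
      funext i j
      simp [shift]
    simp only [lucasSeq, h0, zero_add, mul_one, mul_zero, sub_zero]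
    refine ⟨?_, ?_⟩
    · rw [zero_add]
    · rw [zero_add]; ring
  | succ l ih =>
    obtain ⟨h1, h2⟩ := ih (shift T 1) (fun i hi => hd (1 + i) (by omega))
      (fun i hi => hm (1 + i) (by omega))
      (fun i j hi hij hj => hu (1 + i) (1 + j) (by omega) (by omega) (by omega))
      (fun i j hi hij hj => hl (1 + i) (1 + j) (by omega) (by omega) (by omega))
    have hrec : lucasSeq (-1) z (l + 1 + 1) =
      z * lucasSeq (-1) z (l + 1) + -1 * lucasSeq (-1) z l := rfl
    simp only [shift_shift, add_comm 1 l, add_comm 1 (l + 1)] at h1 h2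
    refine ⟨?_, ?_⟩
    · rw [show l + 1 + p + 1 = l + p + 2 by omega, det_block_add_two T (l + p)
        (fun j h3 h4 => hu 0 j (by omega) (by omega) (by omega))
        (fun j h3 h4 => hl 0 j (by omega) (by omega) (by omega)), hd 0 (by omega),
        hm 0 (by omega), h1, h2, hrec]
      ring
    · rw [show l + 1 + p = l + p + 1 by omega, h1, hrec]
      ring

/-- The cut is at the edge leaving the left cycle; what remains on the right is the second cycle
with a tail of l = ℓ - 1 vertices. The attaching vertex is last in the left cycle and first in the
right one, so deleting it leaves a path in either case. -/
theorem det_block_dumbbell {R : Type*} [CommRing R] (M : ℕ → ℕ → R) (z : R) (m l k : ℕ)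
    (hX : IsUnit (block M (m + 3)).det)
    (hd : ∀ i, i < l → M (m + 3 + i) (m + 3 + i) = z)
    (hm : ∀ i, i < l + 1 → M (m + 2 + i) (m + 2 + i + 1) * M (m + 2 + i + 1) (m + 2 + i) = 1)
    (h0 : ∀ i j, i < m + 3 + l → i + 2 ≤ j → m + 3 ≤ j → j < m + l + k + 6 → M i j = 0)
    (h1 : ∀ i j, i < m + 3 + l → i + 2 ≤ j → m + 3 ≤ j → j < m + l + k + 6 → M j i = 0)
    (hl : IsCycle M z (m + 2)) (hr : IsCycle (shift M (m + 3 + l)) z (k + 2)) :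
    (block M (m + l + k + 6)).det =
      (block M (m + 3)).det *
        ((block (shift M (m + 3 + l)) (k + 3)).det * lucasSeq (-1) z (l + 1) -
          lucasSeq (-1) z (k + 3) * lucasSeq (-1) z l) -
      lucasSeq (-1) z (m + 3) *
        ((block (shift M (m + 3 + l)) (k + 3)).det * lucasSeq (-1) z l -
          lucasSeq (-1) z (k + 3) * (z * lucasSeq (-1) z l - lucasSeq (-1) z (l + 1))) := by
  have hb := det_block_bridge M (m + 2) (l + (k + 2)) hX
    (fun i j hi hj hij => h0 i (m + 3 + j) (by omega) (by omega) (by omega) (by omega))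
    (fun i j hi hj hij => h1 i (m + 3 + j) (by omega) (by omega) (by omega) (by omega))
    (hm 0 (by omega))
  obtain ⟨h2, h3⟩ := det_block_tail (shift M (m + 3)) z l (k + 2) hd
    (fun i hi => by
      have := hm (i + 1) (by omega)
      rwa [show m + 2 + (i + 1) = m + 3 + i by omega] at this)
    (fun i j hi hij hj => h0 (m + 3 + i) (m + 3 + j) (by omega) (by omega) (by omega) (by omega))
    (fun i j hi hij hj => h1 (m + 3 + i) (m + 3 + j) (by omega) (by omega) (by omega) (by omega))
  have hP : (block (shift M (m + 3 + (l + 1))) (k + 2)).det = lucasSeq (-1) z (k + 3) := by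
    have := hr.isPath_shift.det_block
    rwa [shift_shift, add_assoc (m + 3) l 1] at this
  simp only [shift_shift, hP] at h2 h3
  rw [show m + l + k + 6 = m + 2 + 1 + (l + (k + 2) + 1) by omega, hb, h2, h3,
    hl.isPath.det_block]

end NatMatrix

/-! ### Evaluation at z = it. -/

theorem lucasSeq_neg_one_odd (t : ℝ) (k : ℕ) :
    lucasSeq (-1) (Complex.I * t) (2 * k + 1) = (-1) ^ k * (lucasSeq 1 t (2 * k + 1) : ℝ) := by
  have := I_mul_lucasSeq t (2 * k + 1)
  rw [pow_succ, pow_mul, Complex.I_sq] at this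
  exact mul_left_cancel₀ Complex.I_ne_zero (by linear_combination this)

theorem lucasSeq_neg_one_eq (t : ℝ) (k : ℕ) :
    lucasSeq (-1) (Complex.I * t) k = -Complex.I * Complex.I ^ k * (lucasSeq 1 t k : ℝ) := by
  linear_combination -Complex.I * I_mul_lucasSeq t k +
    lucasSeq (-1) (Complex.I * t) k * Complex.I_sq

/-- The value at `i t` of the characteristic polynomial of an odd cycle. -/
theorem odd_cycle_eval (t g : ℝ) {n k : ℕ} (hn : n = 2 * k + 1) :
    Complex.I * t * lucasSeq (-1) (Complex.I * t) n -
        2 * lucasSeq (-1) (Complex.I * t) (n - 1) - 2 * g =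
      (-1) ^ k * Complex.I * ((t * lucasSeq 1 t n + 2 * lucasSeq 1 t (n - 1) : ℝ) -
        2 * Complex.I * ((-1) ^ ((n + 1) / 2) * g : ℝ)) := by
  subst hn
  rw [show (2 * k + 1 + 1) / 2 = k + 1 by omega, Nat.add_sub_cancel, lucasSeq_neg_one_odd,
    lucasSeq_neg_one_eq t (2 * k), pow_mul, Complex.I_sq]
  have h : ((-1 : ℂ) ^ k) * (-1) ^ k = 1 := by rw [← mul_pow]; simp
  push_cast
  rw [pow_succ]
  linear_combination (-2 * g * Complex.I ^ 2 : ℂ) * h - 2 * g * Complex.I_sq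

/-- The squared modulus of the characteristic polynomial of an odd dumbbell at `i t`. -/
theorem normSq_dumbbell_eval (t a a' b b' α β : ℝ) (ε δ : ℂ) (hε : Complex.normSq ε = 1)
    (hδ : Complex.normSq δ = 1) (l : ℕ) (U V : ℝ) (hU : U = lucasSeq 1 t (l + 1))
    (hV : V = lucasSeq 1 t l) :
    Complex.normSq ((ε * Complex.I * (a - 2 * Complex.I * α)) *
        ((δ * Complex.I * (b - 2 * Complex.I * β)) * lucasSeq (-1) (Complex.I * t) (l + 1) -
          (δ * b') * lucasSeq (-1) (Complex.I * t) l) -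
      ε * a' * ((δ * Complex.I * (b - 2 * Complex.I * β)) * lucasSeq (-1) (Complex.I * t) l -
          (δ * b') * (Complex.I * t * lucasSeq (-1) (Complex.I * t) l -
            lucasSeq (-1) (Complex.I * t) (l + 1)))) =
      (a * b * U + (a * b' + a' * b) * V + a' * b' * (U - t * V) - 4 * α * β * U) ^ 2 +
        4 * (α * (b * U + b' * V) + β * (a * U + a' * V)) ^ 2 := by
  have e1 := lucasSeq_neg_one_eq t l
  have e2 := lucasSeq_neg_one_eq t (l + 1)
  rw [← hV] at e1
  rw [← hU, pow_succ] at e2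
  have e2' : lucasSeq (-1) (Complex.I * t) (l + 1) = Complex.I ^ l * U := by
    linear_combination e2 - Complex.I ^ l * U * Complex.I_sq
  rw [e1, e2']
  -- All unimodular factors come out in front, which leaves a complex number with explicit real and
  -- imaginary parts.
  have hW : (ε * Complex.I * (a - 2 * Complex.I * α)) *
        ((δ * Complex.I * (b - 2 * Complex.I * β)) * (Complex.I ^ l * U) -
          (δ * b') * (-Complex.I * Complex.I ^ l * V)) -
      ε * a' * ((δ * Complex.I * (b - 2 * Complex.I * β)) * (-Complex.I * Complex.I ^ l * V) -
          (δ * b') * (Complex.I * t * (-Complex.I * Complex.I ^ l * V) - Complex.I ^ l * U)) =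
      ε * δ * Complex.I ^ l *
        (-((a * b * U + (a * b' + a' * b) * V + a' * b' * (U - t * V) - 4 * α * β * U : ℝ) : ℂ) +
          (2 * (α * (b * U + b' * V) + β * (a * U + a' * V)) : ℝ) * Complex.I) := by
    push_cast
    have h2 := Complex.I_sq
    generalize Complex.I ^ l = J
    linear_combination (ε * δ * J) * (a * b * U - 2 * Complex.I * (b * α + a * β) * U
      + (4 * α * β) * U * (Complex.I ^ 2 - 1) + (a - 2 * Complex.I * α) * b' * V
      + a' * (b - 2 * Complex.I * β) * V - a' * b' * t * V) * h2
  rw [hW, map_mul, map_mul, map_mul, hε, hδ, map_pow, Complex.normSq_I, one_pow, mul_one, one_mul,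
    ← Complex.ofReal_neg, Complex.normSq_add_mul_I]
  ring

/-- The cross terms of the two squares add up to 8αβa'b'(V² - U² + tVU), so the hypothesis turns
them into 8σαβa'b'. -/
theorem odd_dumbbell_form_sub (t a a' b b' α β σ U V : ℝ)
    (hUV : V ^ 2 - U ^ 2 + t * V * U = σ) :
    ((a * b * U + (a * b' + a' * b) * V + a' * b' * (U - t * V)) ^ 2 + 16 * U ^ 2 +
        4 * (b * U + b' * V) ^ 2 + 4 * (a * U + a' * V) ^ 2 + 8 * (a' * b')) -
      ((a * b * U + (a * b' + a' * b) * V + a' * b' * (U - t * V) - 4 * α * β * U) ^ 2 +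
        4 * (α * (b * U + b' * V) + β * (a * U + a' * V)) ^ 2) =
      16 * (1 - α ^ 2 * β ^ 2) * U ^ 2 + 4 * (1 - α ^ 2) * (b * U + b' * V) ^ 2 +
        4 * (1 - β ^ 2) * (a * U + a' * V) ^ 2 + 8 * (a' * b') * (1 - σ * (α * β)) := by
  linear_combination (-8 * α * β * a' * b') * hUV

/-! ### From gain graphs to matrix entries. -/

namespace NatMatrix

/-- The extension by zero of a finite matrix. -/
def ofFin {R : Type*} [Zero R] {n : ℕ} (A : Matrix (Fin n) (Fin n) R) : ℕ → ℕ → R :=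
  fun i j => if h : i < n ∧ j < n then A ⟨i, h.1⟩ ⟨j, h.2⟩ else 0

@[simp]
theorem ofFin_val {R : Type*} [Zero R] {n : ℕ} (A : Matrix (Fin n) (Fin n) R) (i j : Fin n) :
    ofFin A i j = A i j := by
  simp [ofFin]

theorem block_ofFin {R : Type*} [Zero R] {n : ℕ} (A : Matrix (Fin n) (Fin n) R) :
    block (ofFin A) n = A := by
  ext i j
  simp [block]

end NatMatrix

namespace UnitGain

variable {n : ℕ} {G : SimpleGraph (Fin n)}

/-- The matrix `z - A(Φ)`, extended by zero. -/
noncomputable def charEntries (Φ : UnitGain G) (z : ℂ) : ℕ → ℕ → ℂ :=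
  NatMatrix.ofFin (Matrix.scalar (Fin n) z - Φ.adjMatrix)

theorem charEntries_self (Φ : UnitGain G) (z : ℂ) {i : ℕ} (hi : i < n) :
    Φ.charEntries z i i = z := by
  have := NatMatrix.ofFin_val (Matrix.scalar (Fin n) z - Φ.adjMatrix) ⟨i, hi⟩ ⟨i, hi⟩
  simpa [charEntries, adjMatrix] using this

theorem charEntries_of_adj (Φ : UnitGain G) (z : ℂ) {u v : Fin n} (h : G.Adj u v) :
    Φ.charEntries z u v = -(Φ.gain ⟨(u, v), h⟩ : ℂ) := by
  simp [charEntries, adjMatrix, h, h.ne]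

theorem charEntries_of_not_adj (Φ : UnitGain G) (z : ℂ) {i j : ℕ} (hij : i ≠ j)
    (h : ∀ (hi : i < n) (hj : j < n), ¬ G.Adj ⟨i, hi⟩ ⟨j, hj⟩) :
    Φ.charEntries z i j = 0 := by
  rw [charEntries, NatMatrix.ofFin]
  split_ifs with h'
  · simp [adjMatrix, h h'.1 h'.2, hij]
  · rfl

theorem charEntries_of_adj_symm (Φ : UnitGain G) (z : ℂ) {u v : Fin n} (h : G.Adj u v) :
    Φ.charEntries z v u = -(starRingEnd ℂ (Φ.gain ⟨(u, v), h⟩ : ℂ)) := by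
  have h2 : (⟨(v, u), h.symm⟩ : G.Dart) = (⟨(u, v), h⟩ : G.Dart).symm := rfl
  rw [Φ.charEntries_of_adj z h.symm, h2, Φ.gain_symm, Circle.coe_inv_eq_conj]

theorem charEntries_mul (Φ : UnitGain G) (z : ℂ) {i j : ℕ} (hi : i < n) (hj : j < n)
    (h : G.Adj ⟨i, hi⟩ ⟨j, hj⟩) : Φ.charEntries z i j * Φ.charEntries z j i = 1 := by
  have h1 := Φ.charEntries_of_adj z h
  have h2 := Φ.charEntries_of_adj_symm z h
  simp only at h1 h2
  rw [h1, h2, neg_mul_neg, Complex.mul_conj]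
  simp

/-- An embedding has an induced image, so there are no chords and the remaining entries vanish. -/
theorem isCycle_charEntries (Φ : UnitGain G) (z : ℂ) {q a : ℕ}
    (c : SimpleGraph.cycleGraph (q + 3) ↪g G) (hc : ∀ i, (c i : ℕ) = a + i) :
    NatMatrix.IsCycle (NatMatrix.shift (Φ.charEntries z) a) z (q + 2) := by
  have hlt : ∀ i, i < q + 3 → a + i < n := fun i hi => by
    rw [← hc ⟨i, hi⟩]
    exact (c ⟨i, hi⟩).2
  have hc' : ∀ i (hi : i < q + 3), c ⟨i, hi⟩ = ⟨a + i, hlt i hi⟩ := fun i hi => Fin.ext (hc _)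
  have hadj : ∀ i j (hi : i < q + 3) (hj : j < q + 3),
      G.Adj ⟨a + i, hlt i hi⟩ ⟨a + j, hlt j hj⟩ ↔
      i + 1 = j ∨ j + 1 = i ∨ (i = 0 ∧ j + 1 = q + 3) ∨ (j = 0 ∧ i + 1 = q + 3) := by
    intro i j hi hj
    rw [← hc' i hi, ← hc' j hj, c.map_adj_iff, cycleGraph_adj_val (by omega)]
  refine ⟨fun i hi => Φ.charEntries_self z (hlt i hi), fun i hi => ?_, fun i j hij hj hne => ?_,
    fun i j hij hj hne => ?_, ?_⟩
  · exact Φ.charEntries_mul z (hlt i (by omega)) (hlt (i + 1) (by omega))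
      ((hadj i (i + 1) (by omega) (by omega)).2 (by omega))
  · refine Φ.charEntries_of_not_adj z (by omega) fun h1 h2 => ?_
    rw [hadj i j (by omega) (by omega)]
    omega
  · refine Φ.charEntries_of_not_adj z (by omega) fun h1 h2 => ?_
    rw [hadj j i (by omega) (by omega)]
    omega
  · exact Φ.charEntries_mul z (hlt 0 (by omega)) (hlt (q + 2) (by omega))
      ((hadj 0 (q + 2) (by omega) (by omega)).2 (by omega))

theorem coe_cycleGain {V : Type*} {H : SimpleGraph V} (Φ : UnitGain H) {q : ℕ} (hq : 3 ≤ q + 3)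
    (c : SimpleGraph.cycleGraph (q + 3) ↪g H) :
    (Φ.cycleGain hq c : ℂ) =
      ∏ i : Fin (q + 3), (Φ.gain (c.toHom.mapDart (cycleDart (q + 3) hq i)) : ℂ) :=
  map_prod Circle.coeHom _ _

theorem prod_charEntries (Φ : UnitGain G) (z : ℂ) {q a : ℕ} (hq : 3 ≤ q + 3)
    (c : SimpleGraph.cycleGraph (q + 3) ↪g G) (hc : ∀ i, (c i : ℕ) = a + i) :
    Φ.charEntries z (a + (q + 2)) a *
        ∏ i ∈ Finset.range (q + 2), Φ.charEntries z (a + i) (a + (i + 1)) =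
      (-1) ^ (q + 3) * (Φ.cycleGain hq c : ℂ) ∧
    Φ.charEntries z a (a + (q + 2)) *
        ∏ i ∈ Finset.range (q + 2), Φ.charEntries z (a + (i + 1)) (a + i) =
      (-1) ^ (q + 3) * starRingEnd ℂ (Φ.cycleGain hq c : ℂ) := by
  have hrot : ∀ i : Fin (q + 2), finRotate (q + 3) i.castSucc = i.succ := fun i => by
    rw [finRotate_apply, Fin.coeSucc_eq_succ]
  have e : ∀ i : Fin (q + 3), ∀ h : G.Adj (c i) (c (finRotate (q + 3) i)),
    Φ.gain (c.toHom.mapDart (cycleDart (q + 3) hq i)) =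
      Φ.gain ⟨(c i, c (finRotate (q + 3) i)), h⟩ := fun i h => rfl
  have hA : ∀ i : Fin (q + 3), G.Adj (c i) (c (finRotate (q + 3) i)) := fun i =>
    (c.toHom.mapDart (cycleDart (q + 3) hq i)).adj
  have f1 : ∏ i : Fin (q + 3), Φ.charEntries z (c i) (c (finRotate (q + 3) i)) =
      (-1) ^ (q + 3) * (Φ.cycleGain hq c : ℂ) := by
    rw [coe_cycleGain]
    simp_rw [fun i => Φ.charEntries_of_adj z (hA i), fun i => e i (hA i)]
    rw [Finset.prod_neg]
    simp
  have f2 : ∏ i : Fin (q + 3), Φ.charEntries z (c (finRotate (q + 3) i)) (c i) =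
      (-1) ^ (q + 3) * starRingEnd ℂ (Φ.cycleGain hq c : ℂ) := by
    rw [coe_cycleGain, map_prod]
    simp_rw [fun i => Φ.charEntries_of_adj_symm z (hA i), fun i => e i (hA i)]
    rw [Finset.prod_neg]
    simp
  rw [Fin.prod_univ_castSucc] at f1 f2
  rw [← f1, ← f2]
  simp_rw [hrot, finRotate_last, hc, Finset.prod_range]
  simp only [Fin.val_castSucc, Fin.val_succ, Fin.val_last, Fin.val_zero, add_zero]
  exact ⟨mul_comm _ _, mul_comm _ _⟩

/-- The two directions around the cycle contribute γ and its conjugate. The sign (-1)^q of the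
expansion and (-1)^(q+3) from the entries of -A combine to -1 for either parity. -/
theorem det_block_cycle (Φ : UnitGain G) (z : ℂ) {q a : ℕ} (hq : 3 ≤ q + 3)
    (c : SimpleGraph.cycleGraph (q + 3) ↪g G) (hc : ∀ i, (c i : ℕ) = a + i)
    (hu : IsUnit (lucasSeq (-1) z (q + 3))) :
    (NatMatrix.block (NatMatrix.shift (Φ.charEntries z) a) (q + 3)).det =
      z * lucasSeq (-1) z (q + 3) - 2 * lucasSeq (-1) z (q + 2) -
        2 * (Φ.cycleGain hq c : ℂ).re := by
  obtain ⟨h1, h2⟩ := Φ.prod_charEntries z hq c hc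
  rw [(Φ.isCycle_charEntries z c hc).det_block hu]
  simp only [NatMatrix.shift, add_zero]
  rw [h1, h2]
  have h3 := Complex.add_conj (Φ.cycleGain hq c : ℂ)
  have h4 : ((-1 : ℂ) ^ q) * (-1) ^ q = 1 := by rw [← mul_pow]; simp
  rw [pow_add]
  push_cast at h3
  linear_combination - h3 - h4 * (Φ.cycleGain hq c + starRingEnd ℂ (Φ.cycleGain hq c : ℂ))

end UnitGain

/-! ### The dumbbell polynomial and its upper bound. -/

/-- The squared modulus at `i t` of the characteristic polynomial of a gain graph on the dumbbell
graph with odd cycles. -/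
theorem normSq_det_dumbbell {r s ℓ : ℕ} (hr : 3 ≤ r) (hs : 3 ≤ s) (hℓ : 1 ≤ ℓ) (hr_odd : Odd r)
    (hs_odd : Odd s) (Φ : UnitGain (dumbbell r s ℓ)) {t : ℝ} (ht : 0 < t)
    (a a' b b' U V : ℝ) (ha' : a' = lucasSeq 1 t r) (hb' : b' = lucasSeq 1 t s)
    (ha : a = t * lucasSeq 1 t r + 2 * lucasSeq 1 t (r - 1))
    (hb : b = t * lucasSeq 1 t s + 2 * lucasSeq 1 t (s - 1))
    (hU : U = lucasSeq 1 t ℓ) (hV : V = lucasSeq 1 t (ℓ - 1)) :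
    Complex.normSq (Matrix.scalar _ (Complex.I * t) - Φ.adjMatrix).det =
      (a * b * U + (a * b' + a' * b) * V + a' * b' * (U - t * V) -
          4 * oddAlpha hr hs Φ * oddBeta hr hs Φ * U) ^ 2 +
        4 * (oddAlpha hr hs Φ * (b * U + b' * V) + oddBeta hr hs Φ * (a * U + a' * V)) ^ 2 := by
  obtain ⟨m, rfl⟩ : ∃ m, r = m + 3 := ⟨r - 3, by omega⟩
  obtain ⟨k, rfl⟩ : ∃ k, s = k + 3 := ⟨s - 3, by omega⟩
  obtain ⟨l, rfl⟩ : ∃ l, ℓ = l + 1 := ⟨ℓ - 1, by omega⟩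
  obtain ⟨ρ, hρ⟩ := hr_odd
  obtain ⟨σ, hσ⟩ := hs_odd
  set z : ℂ := Complex.I * t with hz
  have hunit : ∀ j, IsUnit (lucasSeq (-1) z (j + 1)) := fun j => by
    rw [isUnit_iff_ne_zero, hz, lucasSeq_neg_one_eq]
    have := (lucasSeq_succ_pos ht j).2.ne'
    simp [Complex.I_ne_zero, this]
  have hcl : ∀ i, (dumbbellLeft (m + 3) (k + 3) (l + 1) hr hs i : ℕ) = 0 + i := fun i =>
    (Nat.zero_add _).symm
  have hcr : ∀ i, (dumbbellRight (m + 3) (k + 3) (l + 1) hr hs i : ℕ) = m + 3 + l + i := fun i => by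
    simp [dumbbellRight]
  have h0 : NatMatrix.shift (Φ.charEntries z) 0 = Φ.charEntries z := by
    funext i j
    simp [NatMatrix.shift]
  have hX := Φ.det_block_cycle z hr (dumbbellLeft (m + 3) (k + 3) (l + 1) hr hs) hcl (hunit _)
  have hY := Φ.det_block_cycle z hs (dumbbellRight (m + 3) (k + 3) (l + 1) hr hs) hcr (hunit _)
  rw [h0] at hX
  replace hX := hX.trans (odd_cycle_eval t _ hρ)
  replace hY := hY.trans (odd_cycle_eval t _ hσ)
  rw [← ha] at hX
  rw [← hb] at hY
  change _ = _ * (_ - 2 * Complex.I * (oddAlpha hr hs Φ : ℝ)) at hX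
  change _ = _ * (_ - 2 * Complex.I * (oddBeta hr hs Φ : ℝ)) at hY
  -- Positivity of this real part makes the left cycle block invertible, as the bridge formula
  -- requires.
  have hapos : 0 < a := by
    have h1 := (lucasSeq_succ_pos ht (m + 2)).2
    have h2 := (lucasSeq_succ_pos ht (m + 2)).1
    rw [ha]
    simp only [show m + 3 - 1 = m + 2 from rfl]
    positivity
  have hXu : IsUnit (NatMatrix.block (Φ.charEntries z) (m + 3)).det := by
    rw [isUnit_iff_ne_zero, hX]
    refine mul_ne_zero (mul_ne_zero (by simp) Complex.I_ne_zero) fun h => ?_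
    have := congrArg Complex.re h
    simp at this
    exact hapos.ne' this
  have hn : m + 3 + (k + 3) + (l + 1) - 1 = m + l + k + 6 := by omega
  have hadj : ∀ i j (hi : i < m + 3 + (k + 3) + (l + 1) - 1)
      (hj : j < m + 3 + (k + 3) + (l + 1) - 1),
      (dumbbell (m + 3) (k + 3) (l + 1)).Adj ⟨i, hi⟩ ⟨j, hj⟩ ↔ i ≠ j ∧
        ((i + 1 = j ∨ (i = 0 ∧ j + 1 = m + 3) ∨
          (i + 1 = m + 3 + (l + 1) ∧ j + 2 = m + 3 + (k + 3) + (l + 1))) ∨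
        (j + 1 = i ∨ (j = 0 ∧ i + 1 = m + 3) ∨
          (j + 1 = m + 3 + (l + 1) ∧ i + 2 = m + 3 + (k + 3) + (l + 1)))) := by
    intro i j hi hj
    simp [dumbbell, SimpleGraph.fromRel_adj]
  have hcyc := Φ.isCycle_charEntries z (dumbbellLeft (m + 3) (k + 3) (l + 1) hr hs) hcl
  rw [h0] at hcyc
  have hdet := NatMatrix.det_block_dumbbell (Φ.charEntries z) z m l k hXu
    (fun i hi => Φ.charEntries_self z (by omega))
    (fun i hi => Φ.charEntries_mul z (by omega) (by omega) ((hadj _ _ _ _).2 (by omega)))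
    (fun i j hi hij hj hj' => Φ.charEntries_of_not_adj z (by omega)
      fun h1 h2 => by rw [hadj]; omega)
    (fun i j hi hij hj hj' => Φ.charEntries_of_not_adj z (by omega)
      fun h1 h2 => by rw [hadj]; omega)
    hcyc (Φ.isCycle_charEntries z (dumbbellRight (m + 3) (k + 3) (l + 1) hr hs) hcr)
  have hP : ∀ j τ, j = 2 * τ + 1 → lucasSeq (-1) z j = (-1) ^ τ * (lucasSeq 1 t j : ℝ) := by
    rintro _ τ rfl
    exact lucasSeq_neg_one_odd t τ
  rw [hX, hY, hP _ ρ hρ, hP _ σ hσ, ← ha', ← hb', ← hn] at hdet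
  have hblock : NatMatrix.block (Φ.charEntries z) _ = Matrix.scalar _ z - Φ.adjMatrix :=
    NatMatrix.block_ofFin _
  rw [hblock] at hdet
  rw [hdet]
  exact normSq_dumbbell_eval t a a' b b' _ _ ((-1) ^ ρ) ((-1) ^ σ) (by simp) (by simp) l U V hU hV

theorem abs_oddAlpha_le {r s ℓ : ℕ} (hr : 3 ≤ r) (hs : 3 ≤ s) (Φ : UnitGain (dumbbell r s ℓ)) :
    |oddAlpha hr hs Φ| ≤ 1 := by
  rw [oddAlpha, abs_mul, abs_pow, abs_neg, abs_one, one_pow, one_mul]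
  exact (Complex.abs_re_le_norm _).trans (Circle.norm_coe _).le

theorem abs_oddBeta_le {r s ℓ : ℕ} (hr : 3 ≤ r) (hs : 3 ≤ s) (Φ : UnitGain (dumbbell r s ℓ)) :
    |oddBeta hr hs Φ| ≤ 1 := by
  rw [oddBeta, abs_mul, abs_pow, abs_neg, abs_one, one_pow, one_mul]
  exact (Complex.abs_re_le_norm _).trans (Circle.norm_coe _).le

theorem exists_form_sub_normSq_det_dumbbell {r s ℓ : ℕ} (hr : 3 ≤ r) (hs : 3 ≤ s) (hℓ : 1 ≤ ℓ)
    (hr_odd : Odd r) (hs_odd : Odd s) {t : ℝ} (ht : 0 < t) :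
    ∃ B c₁ c₂ c₃ c₄ : ℝ, 0 < c₁ ∧ 0 < c₂ ∧ 0 < c₃ ∧ 0 < c₄ ∧
      ∀ Φ : UnitGain (dumbbell r s ℓ),
        B - Complex.normSq (Matrix.scalar _ (Complex.I * t) - Φ.adjMatrix).det =
          c₁ * (1 - oddAlpha hr hs Φ ^ 2 * oddBeta hr hs Φ ^ 2) + c₂ * (1 - oddAlpha hr hs Φ ^ 2) +
          c₃ * (1 - oddBeta hr hs Φ ^ 2) +
          c₄ * (1 - (-1) ^ ℓ * (oddAlpha hr hs Φ * oddBeta hr hs Φ)) := by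
  have hpos : ∀ j, 1 ≤ j → 0 < lucasSeq 1 t j ∧ 0 ≤ lucasSeq 1 t (j - 1) := fun j hj => by
    obtain ⟨j, rfl⟩ : ∃ i, j = i + 1 := ⟨j - 1, by omega⟩
    exact (lucasSeq_succ_pos ht j).symm
  obtain ⟨hr1, hr2⟩ := hpos r (by omega)
  obtain ⟨hs1, hs2⟩ := hpos s (by omega)
  obtain ⟨hl1, hl2⟩ := hpos ℓ hℓ
  have hUV : lucasSeq 1 t (ℓ - 1) ^ 2 - lucasSeq 1 t ℓ ^ 2 +
      t * lucasSeq 1 t (ℓ - 1) * lucasSeq 1 t ℓ = (-1) ^ ℓ := by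
    obtain ⟨l, rfl⟩ : ∃ l, ℓ = l + 1 := ⟨ℓ - 1, by omega⟩
    rw [pow_succ (-1 : ℝ), ← lucasSeq_sq 1 t l, Nat.add_sub_cancel]
    ring
  have key := fun Φ : UnitGain (dumbbell r s ℓ) =>
    normSq_det_dumbbell hr hs hℓ hr_odd hs_odd Φ ht _ _ _ _ _ _ rfl rfl rfl rfl rfl rfl
  -- From here on only the signs of these values and the relation `hUV` matter.
  generalize lucasSeq 1 t (r - 1) = x at *
  generalize lucasSeq 1 t (s - 1) = y at *
  generalize lucasSeq 1 t (ℓ - 1) = V at *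
  generalize lucasSeq 1 t r = a' at *
  generalize lucasSeq 1 t s = b' at *
  generalize lucasSeq 1 t ℓ = U at *
  have ha : 0 < t * a' + 2 * x := by positivity
  have hb : 0 < t * b' + 2 * y := by positivity
  generalize t * a' + 2 * x = a at *
  generalize t * b' + 2 * y = b at *
  refine ⟨(a * b * U + (a * b' + a' * b) * V + a' * b' * (U - t * V)) ^ 2 + 16 * U ^ 2 +
        4 * (b * U + b' * V) ^ 2 + 4 * (a * U + a' * V) ^ 2 + 8 * (a' * b'),
    16 * U ^ 2, 4 * (b * U + b' * V) ^ 2, 4 * (a * U + a' * V) ^ 2, 8 * (a' * b'), by positivity,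
    by positivity, by positivity, by positivity, fun Φ => ?_⟩
  rw [key Φ, odd_dumbbell_form_sub t a a' b b' _ _ _ U V hUV]
  ring

/-- Every summand is nonnegative, so a zero sum forces each of them to vanish. -/
theorem form_nonneg {α β σ c₁ c₂ c₃ c₄ : ℝ} (hα : |α| ≤ 1) (hβ : |β| ≤ 1) (hσ : |σ| ≤ 1)
    (h₁ : 0 < c₁) (h₂ : 0 < c₂) (h₃ : 0 < c₃) (h₄ : 0 < c₄) :
    0 ≤ c₁ * (1 - α ^ 2 * β ^ 2) + c₂ * (1 - α ^ 2) + c₃ * (1 - β ^ 2) + c₄ * (1 - σ * (α * β)) ∧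
    (c₁ * (1 - α ^ 2 * β ^ 2) + c₂ * (1 - α ^ 2) + c₃ * (1 - β ^ 2) + c₄ * (1 - σ * (α * β)) = 0 →
      α ^ 2 = 1 ∧ β ^ 2 = 1 ∧ σ * (α * β) = 1) := by
  have ha : α ^ 2 ≤ 1 := (sq_le_one_iff_abs_le_one α).2 hα
  have hb : β ^ 2 ≤ 1 := (sq_le_one_iff_abs_le_one β).2 hβ
  have hab : α ^ 2 * β ^ 2 ≤ 1 := mul_le_one₀ ha (sq_nonneg _) hb
  have hs : σ * (α * β) ≤ 1 := by
    refine (le_abs_self _).trans ?_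
    rw [abs_mul, abs_mul]
    exact mul_le_one₀ hσ (by positivity) (mul_le_one₀ hα (abs_nonneg _) hβ)
  have e1 := mul_nonneg h₁.le (sub_nonneg.2 hab)
  have e2 := mul_nonneg h₂.le (sub_nonneg.2 ha)
  have e3 := mul_nonneg h₃.le (sub_nonneg.2 hb)
  have e4 := mul_nonneg h₄.le (sub_nonneg.2 hs)
  refine ⟨by linarith, fun h => ⟨?_, ?_, ?_⟩⟩
  · have : c₂ * (1 - α ^ 2) = 0 := by linarith
    rcases mul_eq_zero.1 this with h | h <;> linarith
  · have : c₃ * (1 - β ^ 2) = 0 := by linarith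
    rcases mul_eq_zero.1 this with h | h <;> linarith
  · have : c₄ * (1 - σ * (α * β)) = 0 := by linarith
    rcases mul_eq_zero.1 this with h | h <;> linarith

/-! ### Extremal pairs and their realization. -/

/-- The optimal values of the pair `(α, β)`. -/
def IsExtremalPair (ℓ : ℕ) (α β : ℝ) : Prop :=
  α ^ 2 = 1 ∧ β ^ 2 = 1 ∧ (-1) ^ ℓ * (α * β) = 1

theorem energy_le_of_isExtremalPair {r s ℓ : ℕ} (hr : 3 ≤ r) (hs : 3 ≤ s) (hℓ : 1 ≤ ℓ)
    (hr_odd : Odd r) (hs_odd : Odd s) {Φ : UnitGain (dumbbell r s ℓ)}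
    (hΦ : IsExtremalPair ℓ (oddAlpha hr hs Φ) (oddBeta hr hs Φ)) (Ψ : UnitGain (dumbbell r s ℓ)) :
    Ψ.energy ≤ Φ.energy := by
  refine Matrix.IsHermitian.sum_abs_eigenvalues_le _ _ fun t ht => ?_
  obtain ⟨B, c₁, c₂, c₃, c₄, h₁, h₂, h₃, h₄, h⟩ :=
    exists_form_sub_normSq_det_dumbbell hr hs hℓ hr_odd hs_odd ht
  have e1 := h Φ
  rw [hΦ.1, hΦ.2.1, hΦ.2.2] at e1
  have e2 := (form_nonneg (abs_oddAlpha_le hr hs Ψ) (abs_oddBeta_le hr hs Ψ)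
    (σ := (-1) ^ ℓ) (by simp) h₁ h₂ h₃ h₄).1
  rw [← h Ψ] at e2
  linarith

theorem energy_lt_of_isExtremalPair {r s ℓ : ℕ} (hr : 3 ≤ r) (hs : 3 ≤ s) (hℓ : 1 ≤ ℓ)
    (hr_odd : Odd r) (hs_odd : Odd s) {Φ Ψ : UnitGain (dumbbell r s ℓ)}
    (hΦ : IsExtremalPair ℓ (oddAlpha hr hs Φ) (oddBeta hr hs Φ))
    (hΨ : ¬ IsExtremalPair ℓ (oddAlpha hr hs Ψ) (oddBeta hr hs Ψ)) :
    Ψ.energy < Φ.energy := by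
  refine Matrix.IsHermitian.sum_abs_eigenvalues_lt _ _ fun t ht => ?_
  obtain ⟨B, c₁, c₂, c₃, c₄, h₁, h₂, h₃, h₄, h⟩ :=
    exists_form_sub_normSq_det_dumbbell hr hs hℓ hr_odd hs_odd ht
  have e1 := h Φ
  rw [hΦ.1, hΦ.2.1, hΦ.2.2] at e1
  have e2 := form_nonneg (abs_oddAlpha_le hr hs Ψ) (abs_oddBeta_le hr hs Ψ)
    (σ := (-1) ^ ℓ) (by simp) h₁ h₂ h₃ h₄
  have e3 := e2.1.lt_of_ne' fun h0 => hΨ (e2.2 h0)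
  rw [← h Ψ] at e3
  linarith

theorem isExtremalPair_iff_of_even {ℓ : ℕ} (hℓ : Even ℓ) (α β : ℝ) :
    IsExtremalPair ℓ α β ↔ (α = 1 ∧ β = 1) ∨ (α = -1 ∧ β = -1) := by
  rw [IsExtremalPair, hℓ.neg_one_pow, sq_eq_one_iff, sq_eq_one_iff]
  constructor
  · rintro ⟨h₁ | h₁, h₂ | h₂, h⟩ 
    · norm_num [h₁, h₂]
    · norm_num [h₁, h₂] at h
    · norm_num [h₁, h₂] at h
    · norm_num [h₁, h₂]
  · rintro (⟨rfl, rfl⟩ | ⟨rfl, rfl⟩) <;> simp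

theorem isExtremalPair_iff_of_odd {ℓ : ℕ} (hℓ : Odd ℓ) (α β : ℝ) :
    IsExtremalPair ℓ α β ↔ (α = 1 ∧ β = -1) ∨ (α = -1 ∧ β = 1) := by
  rw [IsExtremalPair, hℓ.neg_one_pow, sq_eq_one_iff, sq_eq_one_iff]
  constructor
  · rintro ⟨h₁ | h₁, h₂ | h₂, h⟩ 
    · norm_num [h₁, h₂] at h
    · norm_num [h₁, h₂]
    · norm_num [h₁, h₂]
    · norm_num [h₁, h₂] at h
  · rintro (⟨rfl, rfl⟩ | ⟨rfl, rfl⟩) <;> simp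

/-- The gain graph on the dumbbell graph with gains `ε` and `δ` on the closing edges of the two
cycles and gain `1` on the other edges. -/
noncomputable def dumbbellGain (r s ℓ : ℕ) (ε δ : Circle) (hε : ε⁻¹ = ε) (hδ : δ⁻¹ = δ) :
    UnitGain (dumbbell r s ℓ) where
  gain d :=
    if ((d.fst : ℕ) = 0 ∧ (d.snd : ℕ) + 1 = r) ∨ ((d.snd : ℕ) = 0 ∧ (d.fst : ℕ) + 1 = r) then ε
    else if ((d.fst : ℕ) + 1 = r + ℓ ∧ (d.snd : ℕ) + 2 = r + s + ℓ) ∨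
      ((d.snd : ℕ) + 1 = r + ℓ ∧ (d.fst : ℕ) + 2 = r + s + ℓ) then δ
    else 1
  gain_symm d := by
    have e1 : d.symm.fst = d.snd := rfl
    have e2 : d.symm.snd = d.fst := rfl
    rw [e1, e2]
    -- The rule ignores orientation, so the inverse law holds because ε and δ are their own
    -- inverses.
    split_ifs <;> first | omega | simp [hε, hδ]

/-- Only the closing dart, the last factor of the product, can have a gain other than 1. -/
theorem cycleGain_left_dumbbellGain {r s ℓ : ℕ} (hr : 3 ≤ r) (hs : 3 ≤ s)
    (ε δ : Circle) (hε : ε⁻¹ = ε) (hδ : δ⁻¹ = δ) :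
    (dumbbellGain r s ℓ ε δ hε hδ).cycleGain hr (dumbbellLeft r s ℓ hr hs) = ε := by
  obtain ⟨q, rfl⟩ : ∃ q, r = q + 3 := ⟨r - 3, by omega⟩
  have hrot : ∀ i : Fin (q + 2), finRotate (q + 3) i.castSucc = i.succ := fun i => by
    rw [finRotate_apply, Fin.coeSucc_eq_succ]
  have e : ∀ i : Fin (q + 3), ∀ b,
      (SimpleGraph.Hom.mapDart (dumbbellLeft (q + 3) s ℓ hr hs).toHom (cycleDart (q + 3) hr i)).fst =
        dumbbellLeft (q + 3) s ℓ hr hs i ∧ (finRotate (q + 3) i = b →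
      (SimpleGraph.Hom.mapDart (dumbbellLeft (q + 3) s ℓ hr hs).toHom (cycleDart (q + 3) hr i)).snd =
        dumbbellLeft (q + 3) s ℓ hr hs b) := fun i b => ⟨rfl, by rintro rfl; rfl⟩
  have hv : ∀ i, (dumbbellLeft (q + 3) s ℓ hr hs i : ℕ) = i := fun i => rfl
  rw [UnitGain.cycleGain, Fin.prod_univ_castSucc, Finset.prod_eq_one, one_mul]
  · rw [dumbbellGain]
    simp only [(e _ 0).1, (e _ _).2 finRotate_last, hv]
    rw [if_pos (by simp)]
  · intro i _
    rw [dumbbellGain]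
    simp only [(e _ 0).1, (e _ _).2 (hrot i), hv, Fin.val_castSucc, Fin.val_succ]
    rw [if_neg (by omega), if_neg (by omega)]

theorem cycleGain_right_dumbbellGain {r s ℓ : ℕ} (hr : 3 ≤ r) (hs : 3 ≤ s) (hℓ : 1 ≤ ℓ)
    (ε δ : Circle) (hε : ε⁻¹ = ε) (hδ : δ⁻¹ = δ) :
    (dumbbellGain r s ℓ ε δ hε hδ).cycleGain hs (dumbbellRight r s ℓ hr hs) = δ := by
  obtain ⟨q, rfl⟩ : ∃ q, s = q + 3 := ⟨s - 3, by omega⟩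
  have hrot : ∀ i : Fin (q + 2), finRotate (q + 3) i.castSucc = i.succ := fun i => by
    rw [finRotate_apply, Fin.coeSucc_eq_succ]
  have e : ∀ i : Fin (q + 3), ∀ b,
      (SimpleGraph.Hom.mapDart (dumbbellRight r (q + 3) ℓ hr hs).toHom (cycleDart (q + 3) hs i)).fst =
        dumbbellRight r (q + 3) ℓ hr hs i ∧ (finRotate (q + 3) i = b →
      (SimpleGraph.Hom.mapDart (dumbbellRight r (q + 3) ℓ hr hs).toHom (cycleDart (q + 3) hs i)).snd =
        dumbbellRight r (q + 3) ℓ hr hs b) := fun i b => ⟨rfl, by rintro rfl; rfl⟩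
  have hv : ∀ i, (dumbbellRight r (q + 3) ℓ hr hs i : ℕ) = r + ℓ - 1 + i := fun i => rfl
  rw [UnitGain.cycleGain, Fin.prod_univ_castSucc, Finset.prod_eq_one, one_mul]
  · rw [dumbbellGain]
    simp only [(e _ 0).1, (e _ _).2 finRotate_last, hv]
    rw [if_neg (by simp; omega), if_pos (by simp; omega)]
  · intro i _
    rw [dumbbellGain]
    simp only [(e _ 0).1, (e _ _).2 (hrot i), hv, Fin.val_castSucc, Fin.val_succ]
    rw [if_neg (by omega), if_neg (by omega)]

theorem exists_circle_inv_eq_self {x : ℝ} (hx : x ^ 2 = 1) :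
    ∃ ε : Circle, ε⁻¹ = ε ∧ (ε : ℂ).re = x := by
  rcases sq_eq_one_iff.1 hx with rfl | rfl
  · exact ⟨1, by simp, by simp⟩
  · exact ⟨-1, by simp, by simp⟩

theorem exists_oddAlpha_oddBeta_eq {r s ℓ : ℕ} (hr : 3 ≤ r) (hs : 3 ≤ s) (hℓ : 1 ≤ ℓ) {x y : ℝ}
    (hx : x ^ 2 = 1) (hy : y ^ 2 = 1) :
    ∃ Φ : UnitGain (dumbbell r s ℓ), oddAlpha hr hs Φ = x ∧ oddBeta hr hs Φ = y := by
  have hsign : ∀ n : ℕ, ((-1 : ℝ) ^ n) * (-1) ^ n = 1 := fun n => by rw [← mul_pow]; simp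
  -- The sign is its own inverse, so it cancels the one in `oddAlpha`.
  obtain ⟨ε, hε, hε'⟩ := exists_circle_inv_eq_self (x := (-1) ^ ((r + 1) / 2) * x)
    (by rw [mul_pow, hx, sq, hsign, one_mul])
  obtain ⟨δ, hδ, hδ'⟩ := exists_circle_inv_eq_self (x := (-1) ^ ((s + 1) / 2) * y)
    (by rw [mul_pow, hy, sq, hsign, one_mul])
  refine ⟨dumbbellGain r s ℓ ε δ hε hδ, ?_, ?_⟩
  · rw [oddAlpha, cycleGain_left_dumbbellGain hr hs, hε', ← mul_assoc, hsign, one_mul]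
  · rw [oddBeta, cycleGain_right_dumbbellGain hr hs hℓ, hδ', ← mul_assoc, hsign, one_mul]

theorem forall_energy_le_iff {r s ℓ : ℕ} (hr : 3 ≤ r) (hs : 3 ≤ s) (hℓ : 1 ≤ ℓ)
    (hr_odd : Odd r) (hs_odd : Odd s) (Φ : UnitGain (dumbbell r s ℓ)) :
    (∀ Ψ : UnitGain (dumbbell r s ℓ), Ψ.energy ≤ Φ.energy) ↔
      IsExtremalPair ℓ (oddAlpha hr hs Φ) (oddBeta hr hs Φ) := by
  refine ⟨fun h => ?_, energy_le_of_isExtremalPair hr hs hℓ hr_odd hs_odd⟩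
  by_contra hΦ
  have hsign : ((-1 : ℝ) ^ ℓ) * (-1) ^ ℓ = 1 := by rw [← mul_pow]; simp
  -- The pair (1, (-1)^ℓ) is extremal for both parities of ℓ, so this Ψ beats any Φ that is not.
  obtain ⟨Ψ, h₁, h₂⟩ := exists_oddAlpha_oddBeta_eq (ℓ := ℓ) hr hs hℓ (x := 1) (y := (-1) ^ ℓ)
    (by simp) (by rw [sq, hsign])
  refine (energy_lt_of_isExtremalPair hr hs hℓ hr_odd hs_odd (Φ := Ψ) ?_ hΦ).not_ge (h Ψ)
  rw [h₁, h₂]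
  exact ⟨by simp, by rw [sq, hsign], by rw [one_mul, hsign]⟩

theorem mainTheorem5 (r s ℓ : ℕ) (hr : 3 ≤ r) (hs : 3 ≤ s) (hℓ : 1 ≤ ℓ)
    (hr_odd : Odd r) (hs_odd : Odd s) :
    (Even ℓ →
      (∀ Φ : UnitGain (dumbbell r s ℓ),
        (∀ Ψ : UnitGain (dumbbell r s ℓ), Ψ.energy ≤ Φ.energy) ↔
          (oddAlpha hr hs Φ = 1 ∧ oddBeta hr hs Φ = 1) ∨
          (oddAlpha hr hs Φ = -1 ∧ oddBeta hr hs Φ = -1)) ∧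
      (∃ Φ : UnitGain (dumbbell r s ℓ), oddAlpha hr hs Φ = 1 ∧ oddBeta hr hs Φ = 1) ∧
      (∃ Φ : UnitGain (dumbbell r s ℓ), oddAlpha hr hs Φ = -1 ∧ oddBeta hr hs Φ = -1)) ∧
    (Odd ℓ →
      (∀ Φ : UnitGain (dumbbell r s ℓ),
        (∀ Ψ : UnitGain (dumbbell r s ℓ), Ψ.energy ≤ Φ.energy) ↔
          (oddAlpha hr hs Φ = 1 ∧ oddBeta hr hs Φ = -1) ∨
          (oddAlpha hr hs Φ = -1 ∧ oddBeta hr hs Φ = 1)) ∧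
      (∃ Φ : UnitGain (dumbbell r s ℓ), oddAlpha hr hs Φ = 1 ∧ oddBeta hr hs Φ = -1) ∧
      (∃ Φ : UnitGain (dumbbell r s ℓ), oddAlpha hr hs Φ = -1 ∧ oddBeta hr hs Φ = 1)) := by
  refine ⟨fun h => ⟨fun Φ => ?_, ?_, ?_⟩, fun h => ⟨fun Φ => ?_, ?_, ?_⟩⟩
  · rw [forall_energy_le_iff hr hs hℓ hr_odd hs_odd, isExtremalPair_iff_of_even h]
  · exact exists_oddAlpha_oddBeta_eq hr hs hℓ (by norm_num) (by norm_num)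
  · exact exists_oddAlpha_oddBeta_eq hr hs hℓ (by norm_num) (by norm_num)
  · rw [forall_energy_le_iff hr hs hℓ hr_odd hs_odd, isExtremalPair_iff_of_odd h]
  · exact exists_oddAlpha_oddBeta_eq hr hs hℓ (by norm_num) (by norm_num)
  · exact exists_oddAlpha_oddBeta_eq hr hs hℓ (by norm_num) (by norm_num)
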